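/- Let $(R,\mathfrak m,k)$ be a (noetherian) Cohen–Macaulay local ring of dimension $d$ that has a canonical module, i.e. a maximal Cohen–Macaulay $R$-module $\omega$ of finite injective dimension with $\dim_k \operatorname{Ext}^d_R(k,\omega)=1$. For a finitely generated $R$-module $M$ let $M^{\mathrm{cm}}\subseteq M$ be the sum of all submodules $\varphi(L)$, where $L$ ranges over all maximal Cohen–Macaulay $R$-modules (nonzero finitely generated modules of depth $d$) without nonzero free direct summands and $\varphi$ ranges over all $R$-linear maps $L\to M$, and let $\delta_R(M)=\mu_R(M/M^{\mathrm{cm}})$, where $\mu_R$ is the minimal number of generators. An ideal $I$ of $R$ is called strongly Cohen–Macaulay if all Koszul homology modules $H_i(I,R)=H_i(x_1,\dots,x_n;R)$, $i\ge 0$, with respect to a finite generating sequence $x_1,\dots,x_n$ of $I$ are Cohen–Macaulay or zero (this does not depend on the choice of the generating sequence). Let $I\neq 0$ be a strongly Cohen–Macaulay ideal of $R$ with $\operatorname{Ann}_R(I)\neq 0$. Then $\delta_R(R/\operatorname{Ann}_R(I))=0$. -/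

import Mathlib

open CategoryTheory

universe u v

/-! ### Depth and Cohen–Macaulay modules -/

section CohenMacaulay

variable (R : Type u) [CommRing R] [IsLocalRing R]
variable (M : Type v) [AddCommGroup M] [Module R M]

/-- The depth of a module over a local ring: the supremum of the lengths of the `M`-regular
sequences in the maximal ideal. (Only used for nonzero finite modules over noetherian rings, where
the supremum is attained.) -/
noncomputable def moduleDepth : ℕ∞ :=
  ⨆ (rs : List R) (_ : (∀ r ∈ rs, r ∈ IsLocalRing.maximalIdeal R) ∧
    RingTheory.Sequence.IsRegular M rs), (rs.length : ℕ∞)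

/-- A finite module is Cohen–Macaulay if it is zero or its depth is its dimension. -/
def IsCohenMacaulayModule : Prop :=
  Module.Finite R M ∧
    (Subsingleton M ∨ ((moduleDepth R M : ℕ∞) : WithBot ℕ∞) = Module.supportDim R M)

/-- A maximal Cohen–Macaulay module: a nonzero finite module whose depth is the dimension of the
ring. -/
def IsMaximalCohenMacaulay : Prop :=
  Module.Finite R M ∧ Nontrivial M ∧ ((moduleDepth R M : ℕ∞) : WithBot ℕ∞) = ringKrullDim R

/-- A Cohen–Macaulay local ring. -/
def IsCohenMacaulayLocalRing : Prop :=
  IsNoetherianRing R ∧ IsCohenMacaulayModule R R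

end CohenMacaulay

/-- A canonical module of a local ring `R` with residue field `k`: a maximal Cohen–Macaulay module
`ω` of finite injective dimension and of type one, i.e. `Ext^d(k, ω)` is one-dimensional over `k`,
where `d = dim R` is the depth of `ω`. -/
def IsCanonicalModule (R : Type u) [CommRing R] [IsLocalRing R]
    (ω : Type u) [AddCommGroup ω] [Module R ω] : Prop :=
  IsMaximalCohenMacaulay R ω ∧
  (∃ n : ℕ, HasInjectiveDimensionLE (ModuleCat.of R ω) n) ∧
  ∃ d : ℕ, ringKrullDim R = d ∧
    Nonempty (Abelian.Ext (ModuleCat.of R (IsLocalRing.ResidueField R)) (ModuleCat.of R ω) d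
      ≃ₗ[R] IsLocalRing.ResidueField R)

/-! ### The Koszul complex -/

section Koszul

variable {R : Type u} [CommRing R] {n : ℕ} (x : Fin n → R)
variable (M : Type v) [AddCommGroup M] [Module R M]

/-- The Koszul chains of degree `i`, i.e. `⋀^i R^n ⊗ M`: the function `f` stands for the sum of
`e_{s₁} ∧ ⋯ ∧ e_{sᵢ} ⊗ f S` over the subsets `S = {s₁ < ⋯ < sᵢ}` of `Fin n`. -/
abbrev KoszulChain (n : ℕ) (M : Type v) (i : ℕ) : Type v :=
  {S : Finset (Fin n) // S.card = i} → M

/-- The sign with which `e_T` occurs in the Koszul boundary of `e_S`, `S = T ∪ {j}`: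
it is `(-1)^p`, where `p` is the number of elements of `S` that are smaller than `j`. -/
def koszulSign (T : Finset (Fin n)) (j : Fin n) : ℤ :=
  (-1) ^ (T.filter (· < j)).card

/-- The Koszul differential
`e_{s₀} ∧ ⋯ ∧ e_{sᵢ} ↦ ∑ p, (-1)^p x_{s_p} • e_{s₀} ∧ ⋯ (omit e_{s_p}) ⋯ ∧ e_{sᵢ}`,
written in coordinates. -/
def koszulDifferential (i : ℕ) : KoszulChain n M (i + 1) →ₗ[R] KoszulChain n M i where
  toFun f T := ∑ j : Fin n, if h : j ∈ T.1 then 0 else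
    koszulSign T.1 j • x j • f ⟨insert j T.1, by rw [Finset.card_insert_of_notMem h, T.2]⟩
  map_add' f g := by
    funext T
    simp only [Pi.add_apply, ← Finset.sum_add_distrib]
    refine Finset.sum_congr rfl fun j _ => ?_
    split_ifs <;> simp
  map_smul' r f := by
    funext T
    simp only [Pi.smul_apply, RingHom.id_apply, Finset.smul_sum]
    refine Finset.sum_congr rfl fun j _ => ?_
    split_ifs
    · simp
    · rw [smul_comm r (koszulSign _ _), smul_comm r (x j)]

theorem koszulSign_swap {T : Finset (Fin n)} {j k : Fin n} (hj : j ∉ T) (hk : k ∉ T)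
    (hjk : j ≠ k) :
    koszulSign T j * koszulSign (insert j T) k = -(koszulSign T k * koszulSign (insert k T) j) := by
  unfold koszulSign
  rcases lt_or_gt_of_ne hjk with h | h
  · have h' : ¬ k < j := not_lt.mpr h.le
    rw [Finset.filter_insert, if_pos h, Finset.filter_insert, if_neg h',
      Finset.card_insert_of_notMem (by simp [hj])]
    ring
  · have h' : ¬ j < k := not_lt.mpr h.le
    rw [Finset.filter_insert, if_neg h', Finset.filter_insert, if_pos h,
      Finset.card_insert_of_notMem (by simp [hk])]
    ring

theorem koszulDifferential_comp (i : ℕ) :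
    koszulDifferential x M i ∘ₗ koszulDifferential x M (i + 1) = 0 := by
  refine LinearMap.ext fun f => ?_
  funext T
  -- the summand of `d (d f)` at `T` that belongs to the pair `(j, k)`
  let F : Fin n × Fin n → M := fun p =>
    if h : p.1 ∉ T.1 ∧ p.2 ∉ insert p.1 T.1 then
      (koszulSign T.1 p.1 * koszulSign (insert p.1 T.1) p.2) • (x p.1 * x p.2) •
        f ⟨insert p.2 (insert p.1 T.1), by
          rw [Finset.card_insert_of_notMem h.2, Finset.card_insert_of_notMem h.1, T.2]⟩
    else 0
  have hF : (koszulDifferential x M i ∘ₗ koszulDifferential x M (i + 1)) f T = ∑ p, F p := by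
    rw [Fintype.sum_prod_type]
    simp only [LinearMap.comp_apply, koszulDifferential, LinearMap.coe_mk, AddHom.coe_mk]
    refine Finset.sum_congr rfl fun j _ => ?_
    by_cases hj : j ∈ T.1
    · simp [F, hj]
    · rw [dif_neg hj, Finset.smul_sum, Finset.smul_sum]
      refine Finset.sum_congr rfl fun k _ => ?_
      by_cases hk : k ∈ insert j T.1
      · simp only [F]
        rw [dif_pos hk, dif_neg (fun h => h.2 hk), smul_zero, smul_zero]
      · simp only [F]
        rw [dif_neg hk, dif_pos ⟨hj, hk⟩, mul_smul, mul_smul,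
          smul_comm (x j) (koszulSign _ _)]
  rw [hF]
  refine Finset.sum_involution (fun p _ => p.swap) ?_ ?_ (by simp) (by simp)
  · rintro ⟨j, k⟩ -
    by_cases h : j ∉ T.1 ∧ k ∉ insert j T.1
    · obtain ⟨hj, hk⟩ := h
      have hk' : k ∉ T.1 := fun h => hk (Finset.mem_insert_of_mem h)
      have hjk : j ≠ k := fun h => hk (h ▸ Finset.mem_insert_self _ _)
      have hj' : j ∉ insert k T.1 := by simp [hj, hjk]
      simp only [F, Prod.swap]
      rw [dif_pos ⟨hj, hk⟩, dif_pos ⟨hk', hj'⟩, koszulSign_swap hj hk' hjk, mul_comm (x k) (x j)]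
      have e : insert k (insert j T.1) = insert j (insert k T.1) := Finset.insert_comm _ _ _
      simp only [e, neg_smul, neg_add_cancel]
    · have h' : ¬ (k ∉ T.1 ∧ j ∉ insert k T.1) := by
        intro h'
        apply h
        obtain ⟨hk, hj⟩ := h'
        simp only [Finset.mem_insert, not_or] at hj ⊢
        exact ⟨hj.2, Ne.symm hj.1, hk⟩
      simp only [F, Prod.swap]
      rw [dif_neg h, dif_neg h', add_zero]
  · rintro ⟨j, k⟩ - hne heq
    simp only [Prod.swap, Prod.mk.injEq] at heq
    apply hne
    obtain rfl := heq.1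
    simp [F]

/-- The Koszul complex `K(x₁, …, xₙ; M)`. -/
noncomputable def koszulComplex : ChainComplex (ModuleCat.{v} R) ℕ :=
  ChainComplex.of (fun i => ModuleCat.of R (KoszulChain n M i))
    (fun i => ModuleCat.ofHom (koszulDifferential x M i))
    (fun i => by
      rw [← ModuleCat.ofHom_comp, koszulDifferential_comp]
      rfl)

/-- The Koszul homology module `H_i(x₁, …, xₙ; M)`. -/
noncomputable abbrev koszulHomology (i : ℕ) : ModuleCat.{v} R :=
  (koszulComplex x M).homology i

end Koszul

/-- An ideal `I` of a local ring `R` is strongly Cohen–Macaulay if all Koszul homology modules of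
`R` with respect to a finite generating sequence of `I` are Cohen–Macaulay (the zero module being
allowed). This does not depend on the generating sequence. -/
def IsStronglyCohenMacaulay {R : Type u} [CommRing R] [IsLocalRing R] (I : Ideal R) : Prop :=
  ∃ (n : ℕ) (x : Fin n → R), Ideal.span (Set.range x) = I ∧
    ∀ i : ℕ, IsCohenMacaulayModule R (koszulHomology x R i)

/-! ### The delta invariant -/

section Delta

variable (R : Type u) [CommRing R]

/-- `M` has no nonzero free direct summand. -/
def HasNoFreeSummand (M : Type v) [AddCommGroup M] [Module R M] : Prop :=
  ∀ F N : Submodule R M, IsCompl F N → Module.Free R F → F = ⊥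

variable [IsLocalRing R]

/-- `M^cm`: the sum of all images `φ(L)`, where `L` ranges over the maximal Cohen–Macaulay modules
without nonzero free direct summand and `φ` over the homomorphisms `L → M`. Every finite `R`-module
is isomorphic to one in the universe of `R`, so that these `L` are all such modules. -/
def cmPart (M : Type v) [AddCommGroup M] [Module R M] : Submodule R M :=
  sSup {N | ∃ (L : ModuleCat.{u} R) (φ : L →ₗ[R] M),
    IsMaximalCohenMacaulay R L ∧ HasNoFreeSummand R L ∧ N = LinearMap.range φ}

/-- Auslander's delta invariant of a finite module `M` over a local ring: the minimal number of
generators of `M / M^cm`. -/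
noncomputable def deltaInvariant (M : Type v) [AddCommGroup M] [Module R M] : ℕ :=
  (⊤ : Submodule R (M ⧸ cmPart R M)).spanFinrank

end Delta

/-!
Under the hypotheses, `R / Ann I` is itself a maximal Cohen–Macaulay module, and it has no nonzero
free direct summand because `Ann I ≠ 0` annihilates it. Hence it is the image of the identity of
such a module, and its delta invariant vanishes.

Let `d = dim R`, let `x₁, …, xₙ` generate `I`, and let `Z_i`, `B_i`, `H_i` be the cycles, the
boundaries and the homology of the Koszul complex `K`. The kernel of the top differential
`K_n = R → K_{n-1}` is `Ann I`, so `R / Ann I ≅ B_{n-1}` (`quotientAnnihilatorEquivRange`). If all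
`H_i` have depth at least `d`, then the sequences `0 → B_i → Z_i → H_i → 0` and
`0 → Z_{i+1} → K_{i+1} → B_i → 0` show inductively that all `Z_i` and `B_i` have depth at least `d`
(`depthGE_koszulCycles_and_boundaries`), which is expressed as the vanishing of `Ext^j(k, -)` for
`j < d`.

As `H_i` is Cohen–Macaulay, it remains to see that its dimension is at least `d`. Choose a prime
`q = Ann(s)` with `s ∈ Ann I`. It is an associated prime of the Cohen–Macaulay ring `R`, so there is
a chain of primes of length `d` above it (`exists_ltSeries_head_eq_of_isRegular`), and it suffices
that `q` lies in the support of `H_i` for `i ≤ n`. This is the rigidity of the Koszul complex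
(`mem_support_koszulHomology`): adding a further element of `q` to the sequence keeps `q` in the
support of the `i`-th homology, by Nakayama's lemma at `q`, and `H_i(x₁, …, x_i) = Ann(x₁, …, x_i)`
contains `s`.
-/

/-! ### Depth, Ext and associated primes -/

section Depth

open IsLocalRing RingTheory.Sequence Abelian Pointwise

variable (R : Type u) [CommRing R] [IsLocalRing R]

/-- The module `M` has depth at least `n`, in homological form: `Ext^i(k, M) = 0` for all `i < n`.
For nonzero finite modules over a noetherian ring, Rees' theorem makes this equivalent to
`n ≤ moduleDepth R M`; unlike that condition, this one holds for the zero module and can be read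
off long exact sequences. -/
def DepthGE (n : ℕ) (M : Type u) [AddCommGroup M] [Module R M] : Prop :=
  ∀ i < n, Subsingleton (Ext (ModuleCat.of R (ResidueField R)) (ModuleCat.of R M) i)

variable {R} {n : ℕ} {M N : Type u} [AddCommGroup M] [Module R M] [AddCommGroup N] [Module R N]

theorem DepthGE.of_linearEquiv (h : DepthGE R n M) (e : M ≃ₗ[R] N) : DepthGE R n N := by
  intro i hi
  have := h i hi
  refine ⟨fun a b => ?_⟩
  have key (c : Ext (ModuleCat.of R (ResidueField R)) (ModuleCat.of R N) i) : c = 0 := by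
    have h0 : c.comp (Ext.mk₀ e.toModuleIso.inv) (add_zero i) = 0 := Subsingleton.elim _ _
    rw [← Ext.comp_mk₀_id c, ← (show _ = 𝟙 _ from e.toModuleIso.inv_hom_id), ← Ext.mk₀_comp_mk₀,
      ← Ext.comp_assoc_of_second_deg_zero, h0, Ext.zero_comp]
  rw [key a, key b]

/-- In `0 → ker f → M → N → 0`, the vanishing of `Ext^i(k, M)` and `Ext^{i-1}(k, N)` forces that of
`Ext^i(k, ker f)`. -/
theorem DepthGE.ker {f : M →ₗ[R] N} (hf : Function.Surjective f) (hM : DepthGE R n M)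
    (hN : DepthGE R n N) : DepthGE R n (LinearMap.ker f) := by
  intro i hi
  have hS := LinearMap.shortExact_shortComplexKer hf
  refine ⟨fun a b => ?_⟩
  have key (c : Ext (ModuleCat.of R (ResidueField R)) (ModuleCat.of R (LinearMap.ker f)) i) :
      c = 0 := by
    have hc : c.comp (Ext.mk₀ f.shortComplexKer.f) (add_zero i) = 0 :=
      (hM i hi).elim _ _
    cases i with
    | zero =>
      have := hS.mono_f
      exact Ext.postcomp_mk₀_injective_of_mono _ f.shortComplexKer.f (by simpa using! hc)
    | succ i =>
      obtain ⟨y, hy⟩ := Ext.covariant_sequence_exact₁ _ hS c hc rfl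
      rw [← hy, (hN i (by omega)).elim y 0, Ext.zero_comp]
  rw [key a, key b]

theorem DepthGE.pi (ι : Type) [Fintype ι] [DecidableEq ι] (hM : DepthGE R n M) :
    DepthGE R n (ι → M) := by
  intro i hi
  have key (c : Ext (ModuleCat.of R (ResidueField R)) (ModuleCat.of R (ι → M)) i) : c = 0 := by
    -- The identity of a finite power is the sum of the composites of the projections with the
    -- inclusions, and each of these factors through `M`.
    have hid : 𝟙 (ModuleCat.of R (ι → M)) = ∑ j : ι,
        ModuleCat.ofHom (LinearMap.proj (R := R) (φ := fun _ : ι => M) j) ≫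
          ModuleCat.ofHom (LinearMap.single R (fun _ : ι => M) j) := by
      ext f
      simp [ModuleCat.hom_sum, Finset.sum_apply, Pi.single_apply]
    have h1 : c.comp (Ext.mk₀ (𝟙 _)) (add_zero i) = c := by simp
    rw [← h1, hid]
    have h2 : Ext.mk₀ (∑ j : ι,
        ModuleCat.ofHom (LinearMap.proj (R := R) (φ := fun _ : ι => M) j) ≫
          ModuleCat.ofHom (LinearMap.single R (fun _ : ι => M) j)) = ∑ j : ι, Ext.mk₀ (
        ModuleCat.ofHom (LinearMap.proj (R := R) (φ := fun _ : ι => M) j) ≫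
          ModuleCat.ofHom (LinearMap.single R (fun _ : ι => M) j)) :=
      map_sum Ext.addEquiv₀.symm _ _
    rw [h2, Ext.comp_sum]
    refine Finset.sum_eq_zero fun j _ => ?_
    rw [← Ext.mk₀_comp_mk₀, ← Ext.comp_assoc_of_second_deg_zero,
      (hM i hi).elim (c.comp _ _) 0, Ext.zero_comp]
  exact ⟨fun a b => by rw [key a, key b]⟩

theorem support_residueField :
    Module.support R (ResidueField R) = PrimeSpectrum.zeroLocus (maximalIdeal R) := by
  have : Module.annihilator R (ResidueField R) = maximalIdeal R :=
    Ideal.annihilator_quotient (I := maximalIdeal R)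
  rw [Module.support_eq_zeroLocus, this]

theorem maximalIdeal_smul_top_lt [Module.Finite R M] [Nontrivial M] :
    maximalIdeal R • (⊤ : Submodule R M) < ⊤ := by
  refine lt_top_iff_ne_top.2 (Ne.symm ?_)
  refine Submodule.top_ne_ideal_smul_of_le_jacobson_annihilator ?_
  exact (maximalIdeal_le_jacobson _)

variable [IsNoetherianRing R] [Module.Finite R M]

/-- One half of Rees' theorem: a regular sequence of length at least `n` makes the `Ext` modules
below degree `n` vanish. -/
theorem DepthGE.of_le_moduleDepth [Nontrivial M] (h : (n : ℕ∞) ≤ moduleDepth R M) :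
    DepthGE R n M := by
  rcases n with _ | n
  · intro i hi; omega
  -- The depth is a supremum; a strict lower bound is exceeded by one of the sequences.
  have h' : (n : ℕ∞) < moduleDepth R M := lt_of_lt_of_le (by exact_mod_cast n.lt_succ_self) h
  obtain ⟨rs, h'⟩ := lt_iSup_iff.1 h'
  obtain ⟨⟨hrs, hreg⟩, h'⟩ := lt_iSup_iff.1 h'
  have hlen : n < rs.length := by exact_mod_cast h'
  intro i hi
  exact ModuleCat.subsingleton_ext_of_exists_isRegular (maximalIdeal R)
    (ModuleCat.of R (ResidueField R)) support_residueField.subset (ModuleCat.of R M)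
    maximalIdeal_smul_top_lt rs hrs hreg i (by omega)

/-- The other half of Rees' theorem: the vanishing of the `Ext` modules below degree `n` produces a
regular sequence of length `n`. -/
theorem DepthGE.le_moduleDepth [Nontrivial M] (h : DepthGE R n M) :
    (n : ℕ∞) ≤ moduleDepth R M := by
  obtain ⟨rs, hlen, hrs, hreg⟩ := ModuleCat.exists_isRegular_of_exists_subsingleton_ext
    (maximalIdeal R) n (ModuleCat.of R M) maximalIdeal_smul_top_lt
    (ModuleCat.of R (ResidueField R)) support_residueField h
  rw [← hlen]
  exact le_iSup₂_of_le rs ⟨hrs, hreg⟩ le_rfl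

/-- An `M`-regular sequence of length `r` in the maximal ideal yields, for every associated prime
`p` of `M`, a chain of primes of length `r` that starts at `p`. By induction on the sequence: if
`x` is its first entry, then some associated prime of `M / xM` contains `p + (x)`. -/
theorem exists_ltSeries_head_eq_of_isRegular (rs : List R) (hrs : ∀ r ∈ rs, r ∈ maximalIdeal R)
    (hreg : IsRegular M rs) (p : PrimeSpectrum R) (hp : IsAssociatedPrime p.asIdeal M) :
    ∃ s : LTSeries (PrimeSpectrum R), s.head = p ∧ s.length = rs.length := by
  induction rs generalizing M p with
  | nil => exact ⟨RelSeries.singleton _ p, by simp, by simp⟩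
  | cons x rs ih =>
    obtain ⟨hx, hreg⟩ := (isRegular_cons_iff M x rs).1 hreg
    obtain ⟨hprime, m₀, hm₀⟩ := (isAssociatedPrime_iff).1 hp
    have hmem (r : R) : r ∈ p.asIdeal ↔ r • m₀ = 0 := by
      rw [hm₀, Submodule.mem_colon_singleton, Submodule.mem_bot]
    have hm₀ne : m₀ ≠ 0 := fun h => hprime.ne_top <| by
      rw [Ideal.eq_top_iff_one, hmem, h, smul_zero]
    have hxp : x ∉ p.asIdeal := fun h => hm₀ne (hx.right_eq_zero_of_smul ((hmem x).1 h))
    let T : Submodule R M := Submodule.torsionBySet R M p.asIdeal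
    have hT (m : M) : m ∈ T ↔ ∀ r ∈ p.asIdeal, r • m = 0 := by
      simp [T, Submodule.mem_torsionBySet_iff]
    -- As `x` is regular, `T ∩ xM = xT`, so `T ⊆ xM` would give `T = 0` by Nakayama's lemma. An
    -- element of `T` outside `xM` has a nonzero image in `M / xM` that `p + (x)` annihilates.
    obtain ⟨m, hmT, hm⟩ : ∃ m ∈ T, m ∉ x • (⊤ : Submodule R M) := by
      by_contra! hcon
      have hle : T ≤ Ideal.span {x} • T := by
        intro m hm
        obtain ⟨m', -, rfl⟩ := (Submodule.mem_smul_pointwise_iff_exists _ _ _).1 (hcon m hm)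
        refine Submodule.smul_mem_smul (Ideal.mem_span_singleton_self x) ((hT m').2 fun r hr => ?_)
        refine hx.right_eq_zero_of_smul ?_
        rw [smul_comm]
        exact (hT _).1 hm r hr
      have hbot := Submodule.eq_bot_of_le_smul_of_le_jacobson_bot (Ideal.span {x}) T
        (IsNoetherian.noetherian T) hle (by
          rw [Ideal.span_singleton_le_iff_mem, jacobson_eq_maximalIdeal ⊥ bot_ne_top]
          exact hrs x List.mem_cons_self)
      have : m₀ ∈ T := (hT m₀).2 fun r hr => (hmem r).1 hr
      rw [hbot] at this
      exact hm₀ne this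
    have hy : (Submodule.Quotient.mk m : QuotSMulTop x M) ≠ 0 := by
      rwa [Ne, Submodule.Quotient.mk_eq_zero]
    obtain ⟨P, hP, hle⟩ := exists_le_isAssociatedPrime_of_isNoetherianRing R _ hy
    have hlt : p < ⟨P, hP.isPrime⟩ := by
      refine (PrimeSpectrum.asIdeal_lt_asIdeal _ _).1 (lt_of_le_of_ne (fun r hr => hle ?_) ?_)
      · rw [Submodule.mem_colon_singleton, Submodule.mem_bot, ← Submodule.Quotient.mk_smul,
          (hT m).1 hmT r hr, Submodule.Quotient.mk_zero]
      · intro h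
        refine hxp (h ▸ hle ?_)
        rw [Submodule.mem_colon_singleton, Submodule.mem_bot, ← Submodule.Quotient.mk_smul,
          Submodule.Quotient.mk_eq_zero]
        exact Submodule.smul_mem_pointwise_smul _ _ _ trivial
    obtain ⟨s, hs, hlen⟩ := ih (fun r hr => hrs r (List.mem_cons_of_mem _ hr)) hreg
      ⟨P, hP.isPrime⟩ hP
    exact ⟨s.cons p (by rw [hs]; exact hlt), by simp, by simp [hlen]⟩

/-- If an associated prime `p` of `M` lies in the support of `N`, then
`dim N ≥ dim R/p ≥ depth M`. -/
theorem le_supportDim_of_isAssociatedPrime [Nontrivial M] (h : (n : ℕ∞) ≤ moduleDepth R M)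
    {p : PrimeSpectrum R} (hp : IsAssociatedPrime p.asIdeal M) {N : Type*} [AddCommGroup N]
    [Module R N] (hN : p ∈ Module.support R N) : (n : WithBot ℕ∞) ≤ Module.supportDim R N := by
  obtain ⟨rs, hlen, hrs, hreg⟩ := ModuleCat.exists_isRegular_of_exists_subsingleton_ext
    (maximalIdeal R) n (ModuleCat.of R M) maximalIdeal_smul_top_lt
    (ModuleCat.of R (ResidueField R)) support_residueField (DepthGE.of_le_moduleDepth h)
  obtain ⟨s, hs, hslen⟩ := exists_ltSeries_head_eq_of_isRegular rs hrs hreg p hp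
  let s' : LTSeries (Module.support R N) :=
    { length := s.length
      toFun := fun j => ⟨s j, Module.mem_support_mono (hs ▸ s.head_le j) hN⟩
      step := s.step }
  rw [← hlen, ← hslen]
  exact Order.LTSeries.length_le_krullDim s'

end Depth

/-! ### Koszul homology as cycles modulo boundaries -/

section KoszulHomology

variable {R : Type u} [CommRing R] {n : ℕ} (x : Fin n → R)
variable (M : Type v) [AddCommGroup M] [Module R M]

/-- The cycles of the Koszul complex in degree `i`; in degree `0` these are all chains. -/
def koszulCycles : (i : ℕ) → Submodule R (KoszulChain n M i)
  | 0 => ⊤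
  | i + 1 => LinearMap.ker (koszulDifferential x M i)

theorem range_koszulDifferential_le (i : ℕ) :
    LinearMap.range (koszulDifferential x M i) ≤ koszulCycles x M i := by
  cases i with
  | zero => exact le_top
  | succ i => exact LinearMap.range_le_ker_iff.2 (koszulDifferential_comp x M i)

theorem koszulComplex_d (i : ℕ) : (koszulComplex x M).d (i + 1) i =
    ModuleCat.ofHom (koszulDifferential x M i) :=
  ChainComplex.of_d (fun i => ModuleCat.of R (KoszulChain n M i))
    (fun i => ModuleCat.ofHom (koszulDifferential x M i)) i

/-- For `i = 0` the truncated subtraction gives the map from degree `0` to itself, which is zero,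
so that its kernel consists of all chains. -/
theorem ker_koszulComplex_d_pred (i : ℕ) :
    LinearMap.ker ((koszulComplex x M).d i (i - 1)).hom = koszulCycles x M i := by
  cases i with
  | zero =>
    have : (koszulComplex x M).d 0 (0 - 1) = 0 := (koszulComplex x M).shape _ _ (by simp)
    rw [this]
    exact LinearMap.ker_zero
  | succ i =>
    have := koszulComplex_d x M i
    exact (congrArg (fun f => LinearMap.ker (ModuleCat.Hom.hom f)) this)

/-- Koszul homology, which is defined through the homology of a chain complex, is the quotient of
the concrete cycles by the range of the concrete differential. -/
theorem exists_cycles_to_koszulHomology (i : ℕ) :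
    ∃ π : koszulCycles x M i →ₗ[R] koszulHomology x M i, Function.Surjective π ∧
      ∀ z, π z = 0 ↔ (z : KoszulChain n M i) ∈ LinearMap.range (koszulDifferential x M i) := by
  have hprev : (ComplexShape.down ℕ).prev i = i + 1 := by simp
  have hnext : (ComplexShape.down ℕ).next i = i - 1 := by
    cases i with
    | zero => exact ChainComplex.next_nat_zero
    | succ i => exact ChainComplex.next_nat_succ i
  let S := (koszulComplex x M).sc' (i + 1) i (i - 1)
  let e : koszulHomology x M i ≅ S.moduleCatLeftHomologyData.H :=
    (ShortComplex.homologyMapIso ((koszulComplex x M).isoSc' (i + 1) i (i - 1) hprev hnext)) ≪≫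
      S.moduleCatHomologyIso
  let c : koszulCycles x M i ≃ₗ[R] LinearMap.ker S.g.hom :=
    LinearEquiv.ofEq _ _ (ker_koszulComplex_d_pred x M i).symm
  refine ⟨e.toLinearEquiv.symm.toLinearMap ∘ₗ
    (LinearMap.range S.moduleCatToCycles).mkQ ∘ₗ c.toLinearMap, ?_, fun z => ?_⟩
  · exact e.toLinearEquiv.symm.surjective.comp ((Submodule.mkQ_surjective _).comp c.surjective)
  · have hf : S.f.hom = koszulDifferential x M i :=
      congrArg ModuleCat.Hom.hom (koszulComplex_d x M i)
    have h1 : (e.toLinearEquiv.symm.toLinearMap ∘ₗ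
      (LinearMap.range S.moduleCatToCycles).mkQ ∘ₗ c.toLinearMap) z = 0 ↔
        c z ∈ LinearMap.range S.moduleCatToCycles := by
      rw [← Submodule.Quotient.mk_eq_zero]
      exact e.toLinearEquiv.symm.map_eq_zero_iff
    rw [h1, ← hf]
    constructor
    · rintro ⟨w, hw⟩
      exact ⟨w, congrArg Subtype.val hw⟩
    · rintro ⟨w, hw⟩
      exact ⟨w, Subtype.ext hw⟩

end KoszulHomology

/-! ### Rigidity of the Koszul complex -/

section Rigidity

variable {R : Type u} [CommRing R] {n : ℕ} (x : Fin n → R)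
variable (M : Type v) [AddCommGroup M] [Module R M]

theorem koszulDifferential_apply (i : ℕ) (f : KoszulChain n M (i + 1))
    (T : {S : Finset (Fin n) // S.card = i}) :
    koszulDifferential x M i f T = ∑ j : Fin n, if h : j ∈ T.1 then 0 else
      koszulSign T.1 j • x j • f ⟨insert j T.1, by rw [Finset.card_insert_of_notMem h, T.2]⟩ := rfl

variable (R) in
/-- The chains supported on the subsets of `A`, that is, the image of the Koszul chains of the
subsequence `(x_a)_{a ∈ A}`. -/
def koszulSupported (A : Finset (Fin n)) (i : ℕ) : Submodule R (KoszulChain n M i) where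
  carrier := {f | ∀ S, ¬ S.1 ⊆ A → f S = 0}
  zero_mem' := fun _ _ => rfl
  add_mem' := fun hf hg S hS => by simp [hf S hS, hg S hS]
  smul_mem' := fun r f hf S hS => by simp [hf S hS]

variable {M}

theorem koszulDifferential_mem_supported {A : Finset (Fin n)} {i : ℕ}
    {f : KoszulChain n M (i + 1)} (hf : f ∈ koszulSupported R M A (i + 1)) :
    koszulDifferential x M i f ∈ koszulSupported R M A i := by
  intro T hT
  rw [koszulDifferential_apply]
  refine Finset.sum_eq_zero fun j _ => ?_
  split_ifs with h
  · rfl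
  · rw [hf _ fun hsub => hT ((Finset.subset_insert _ _).trans hsub), smul_zero, smul_zero]

theorem koszulSign_mul_self (T : Finset (Fin n)) (j : Fin n) :
    koszulSign T j * koszulSign T j = 1 := by
  unfold koszulSign
  rw [← mul_pow]
  simp

variable (M) in
/-- The contraction with the coordinate form dual to `e_a`: it sends `e_a ∧ e_T` to `e_T` for
`a ∉ T`, and `e_S` to `0` for `a ∉ S`. -/
def koszulContract (a : Fin n) (i : ℕ) : KoszulChain n M (i + 1) →ₗ[R] KoszulChain n M i where
  toFun f T := if h : a ∈ T.1 then 0 else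
    koszulSign T.1 a • f ⟨insert a T.1, by rw [Finset.card_insert_of_notMem h, T.2]⟩
  map_add' f g := by
    funext T
    simp only [Pi.add_apply]
    split_ifs <;> simp
  map_smul' r f := by
    funext T
    simp only [Pi.smul_apply, RingHom.id_apply]
    split_ifs
    · simp
    · rw [smul_comm r (koszulSign _ _)]

theorem koszulContract_apply (a : Fin n) (i : ℕ) (f : KoszulChain n M (i + 1))
    (T : {S : Finset (Fin n) // S.card = i}) :
    koszulContract (R := R) M a i f T = if h : a ∈ T.1 then 0 else
      koszulSign T.1 a • f ⟨insert a T.1, by rw [Finset.card_insert_of_notMem h, T.2]⟩ := rfl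

/-- The differential is itself a contraction, with the form `x`, so it anticommutes with the
contraction by a coordinate form. -/
theorem koszulDifferential_contract (a : Fin n) (i : ℕ) (f : KoszulChain n M (i + 2)) :
    koszulDifferential x M i (koszulContract (R := R) M a (i + 1) f) =
      -koszulContract (R := R) M a i (koszulDifferential x M (i + 1) f) := by
  funext T
  rw [Pi.neg_apply, koszulContract_apply, koszulDifferential_apply]
  by_cases ha : a ∈ T.1
  · rw [dif_pos ha, neg_zero]
    refine Finset.sum_eq_zero fun j _ => ?_
    split_ifs with h
    · rfl
    · rw [koszulContract_apply, dif_pos (Finset.mem_insert_of_mem ha), smul_zero, smul_zero]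
  · rw [dif_neg ha, koszulDifferential_apply, Finset.smul_sum, ← Finset.sum_neg_distrib]
    refine Finset.sum_congr rfl fun j _ => ?_
    by_cases hj : j ∈ T.1
    · rw [dif_pos hj, dif_pos (Finset.mem_insert_of_mem hj), smul_zero, neg_zero]
    rw [dif_neg hj, koszulContract_apply]
    by_cases hja : j = a
    · subst hja
      rw [dif_pos (Finset.mem_insert_self _ _), dif_pos (Finset.mem_insert_self _ _)]
      simp
    · have hja' : j ∉ insert a T.1 := by simp [hj, hja]
      have haj' : a ∉ insert j T.1 := by simp [ha, Ne.symm hja]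
      rw [dif_neg hja', dif_neg haj', smul_comm (x j) (koszulSign _ _), ← mul_smul, ← mul_smul,
        koszulSign_swap hj ha hja, neg_smul]
      simp only [Finset.insert_comm a j]

/-- Write a chain on `A ∪ {a}` as `u = w + e_a ∧ v` with `w` and `v` supported on `A`. If `d u` is
supported on `A`, then `v` is a cycle and `d u = d w + x_a v`. -/
theorem exists_eq_differential_add_smul {a : Fin n} {A : Finset (Fin n)} (ha : a ∉ A) {i : ℕ}
    {u : KoszulChain n M (i + 1)} (hu : u ∈ koszulSupported R M (insert a A) (i + 1))
    (hdu : koszulDifferential x M i u ∈ koszulSupported R M A i) :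
    ∃ w ∈ koszulSupported R M A (i + 1), ∃ v ∈ koszulSupported R M A i ⊓ koszulCycles x M i,
      koszulDifferential x M i u = koszulDifferential x M i w + x a • v := by
  have hv : koszulContract (R := R) M a i u ∈ koszulSupported R M A i := by
    intro T hT
    rw [koszulContract_apply]
    split_ifs with h
    · rfl
    · rw [hu, smul_zero]
      intro hsub
      refine hT fun j hj => ?_
      rcases Finset.mem_insert.1 (hsub (Finset.mem_insert_of_mem hj)) with rfl | h'
      · exact absurd hj h
      · exact h'
  let w : KoszulChain n M (i + 1) := fun S => if a ∈ S.1 then 0 else u S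
  have hw : w ∈ koszulSupported R M A (i + 1) := by
    intro S hS
    by_cases h : a ∈ S.1
    · simp [w, h]
    · simp only [w, if_neg h]
      refine hu S fun hsub => hS fun j hj => ?_
      rcases Finset.mem_insert.1 (hsub hj) with rfl | h'
      · exact absurd hj h
      · exact h'
  refine ⟨w, hw, koszulContract (R := R) M a i u, ⟨hv, ?_⟩, ?_⟩
  · cases i with
    | zero => trivial
    | succ i =>
      change koszulDifferential x M i _ = 0
      rw [koszulDifferential_contract, neg_eq_zero]
      funext T
      rw [koszulContract_apply]
      split_ifs with h
      · rfl
      · rw [hdu _ fun hsub => ha (hsub (Finset.mem_insert_self _ _)), smul_zero]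
        rfl
  · funext T
    by_cases haT : a ∈ T.1
    · have hTA : ¬ T.1 ⊆ A := fun hsub => ha (hsub haT)
      rw [hdu T hTA, Pi.add_apply, koszulDifferential_mem_supported x hw T hTA, Pi.smul_apply,
        hv T hTA, smul_zero, add_zero]
    · rw [Pi.add_apply, Pi.smul_apply, koszulContract_apply, dif_neg haT,
        koszulDifferential_apply, koszulDifferential_apply,
        ← Finset.add_sum_erase _ _ (Finset.mem_univ a),
        ← Finset.add_sum_erase Finset.univ (fun j => if h : j ∈ T.1 then 0 else
          koszulSign T.1 j • x j • w ⟨insert j T.1, by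
            rw [Finset.card_insert_of_notMem h, T.2]⟩) (Finset.mem_univ a)]
      rw [dif_neg haT, dif_neg haT]
      have hwa : w ⟨insert a T.1, by rw [Finset.card_insert_of_notMem haT, T.2]⟩ = 0 := by
        simp [w]
      rw [hwa, smul_zero, smul_zero, zero_add, add_comm, smul_comm (x a) (koszulSign _ _)]
      congr 1
      refine Finset.sum_congr rfl fun j hj => ?_
      have hja : j ≠ a := (Finset.mem_erase.1 hj).1
      split_ifs with h
      · rfl
      · have : a ∉ insert j T.1 := by simp [haT, Ne.symm hja]
        simp [w, this]

/-- Nakayama's lemma at a prime `q` in the support of `N`: if `I ⊆ q` and `t N ⊆ I N`, then `t ∈ q`,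
because `q` also lies in the support of `N / I N`. -/
theorem mem_of_smul_mem_smul_top {q I : Ideal R} [q.IsPrime] (hI : I ≤ q) {N : Type*}
    [AddCommGroup N] [Module R N] [Module.Finite R N] (hN : ⟨q, ‹_›⟩ ∈ Module.support R N) {t : R}
    (ht : ∀ m : N, t • m ∈ I • (⊤ : Submodule R N)) : t ∈ q := by
  have h : (⟨q, ‹_›⟩ : PrimeSpectrum R) ∈ Module.support R (N ⧸ (I • (⊤ : Submodule R N))) := by
    rw [Module.support_quotient]
    exact ⟨hN, hI⟩
  rw [Module.mem_support_iff_of_finite] at h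
  refine h (Module.mem_annihilator.2 fun m => ?_)
  obtain ⟨m, rfl⟩ := Submodule.Quotient.mk_surjective _ m
  rw [← Submodule.Quotient.mk_smul, Submodule.Quotient.mk_eq_zero]
  exact ht m

/-- The inductive step of rigidity. The condition on `A` says that `q` contains every element
annihilating the `i`-th homology of the Koszul complex on `(x_a)_{a ∈ A}`; it is inherited by
`A ∪ {a}` if `x_a ∈ q`. Indeed, if `t` annihilates the homology for `A ∪ {a}`, it multiplies the
homology for `A` into its multiple by `x_a`. -/
theorem mem_of_smul_cycles_le_insert [IsNoetherianRing R] [Module.Finite R M]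
    {q : Ideal R} [q.IsPrime] {i : ℕ} {a : Fin n} (hxa : x a ∈ q) {A : Finset (Fin n)}
    (hA : ∀ t : R, (∀ z ∈ koszulSupported R M A i ⊓ koszulCycles x M i,
      ∃ w ∈ koszulSupported R M A (i + 1), koszulDifferential x M i w = t • z) → t ∈ q)
    {t : R} (ht : ∀ z ∈ koszulSupported R M (insert a A) i ⊓ koszulCycles x M i,
      ∃ w ∈ koszulSupported R M (insert a A) (i + 1), koszulDifferential x M i w = t • z) :
    t ∈ q := by
  by_cases ha : a ∈ A
  · rw [Finset.insert_eq_of_mem ha] at ht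
    exact hA t ht
  let Z := koszulSupported R M A i ⊓ koszulCycles x M i
  let B := ((koszulSupported R M A (i + 1)).map (koszulDifferential x M i)).submoduleOf Z
  refine mem_of_smul_mem_smul_top (q := q) (I := Ideal.span {x a}) (N := Z ⧸ B)
    ((Ideal.span_singleton_le_iff_mem _).2 hxa) ?_ fun m => ?_
  · rw [Module.mem_support_iff_of_finite]
    intro t' ht'
    refine hA t' fun z hz => ?_
    have := Module.mem_annihilator.1 ht' (Submodule.Quotient.mk ⟨z, hz⟩)
    rw [← Submodule.Quotient.mk_smul, Submodule.Quotient.mk_eq_zero] at this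
    exact this
  · obtain ⟨⟨z, hz⟩, rfl⟩ := Submodule.Quotient.mk_surjective _ m
    have hle : koszulSupported R M A i ≤ koszulSupported R M (insert a A) i :=
      fun f hf S hS => hf S fun h => hS (h.trans (Finset.subset_insert _ _))
    obtain ⟨u, hu, hdu⟩ := ht z ⟨hle hz.1, hz.2⟩
    obtain ⟨w, hw, v, hv, h⟩ := exists_eq_differential_add_smul x ha hu
      (hdu ▸ Submodule.smul_mem _ _ hz.1)
    have key : (Submodule.Quotient.mk (t • ⟨z, hz⟩ : Z) : Z ⧸ B) =
        x a • Submodule.Quotient.mk ⟨v, hv⟩ := by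
      rw [← Submodule.Quotient.mk_smul, Submodule.Quotient.eq]
      refine ⟨w, hw, ?_⟩
      change _ = t • z - x a • v
      rw [← hdu, h, add_sub_cancel_right]
    rw [← Submodule.Quotient.mk_smul, key]
    exact Submodule.smul_mem_smul (Ideal.mem_span_singleton_self _) trivial

/-- If the prime `q` is the annihilator of an element `s` that is killed by all `x_j`, then `q` lies
in the support of `H_i(x₁, …, xₙ; M)` for all `i ≤ n`. -/
theorem mem_support_koszulHomology [IsNoetherianRing R] [Module.Finite R M]
    {q : PrimeSpectrum R} (hx : ∀ j, x j ∈ q.asIdeal) {s : M} (hs : ∀ j, x j • s = 0)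
    (hq : ∀ t : R, t • s = 0 → t ∈ q.asIdeal) {i : ℕ} (hi : i ≤ n)
    [Module.Finite R (koszulHomology x M i)] :
    q ∈ Module.support R (koszulHomology x M i) := by
  obtain ⟨A₀, -, hA₀⟩ := Finset.exists_subset_card_eq (s := (Finset.univ : Finset (Fin n)))
    (n := i) (by simpa using hi)
  -- The complex on the `i` elements of `A₀` has no chains of degree `i + 1`, and `s • e_{A₀}` is a
  -- cycle in its top degree.
  have hbase : ∀ t : R, (∀ z ∈ koszulSupported R M A₀ i ⊓ koszulCycles x M i,
      ∃ w ∈ koszulSupported R M A₀ (i + 1), koszulDifferential x M i w = t • z) →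
        t ∈ q.asIdeal := by
    intro t ht
    let z : KoszulChain n M i := fun S => if S.1 = A₀ then s else 0
    obtain ⟨w, hw, hdw⟩ := ht z ⟨fun S hS => if_neg fun h => hS h.subset, by
      cases i with
      | zero => trivial
      | succ i =>
        funext T
        rw [koszulDifferential_apply]
        refine Finset.sum_eq_zero fun j _ => ?_
        split_ifs with h
        · rfl
        · simp only [z]
          split_ifs <;> simp [hs]⟩
    have hw0 : w = 0 := funext fun S => hw S fun h => by
      have := Finset.card_le_card h
      have := S.2
      omega
    refine hq t ?_
    have := congrFun hdw ⟨A₀, hA₀⟩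
    rw [hw0, map_zero] at this
    simpa [z] using this.symm
  have hstep : ∀ B : Finset (Fin n), ∀ t : R,
      (∀ z ∈ koszulSupported R M (A₀ ∪ B) i ⊓ koszulCycles x M i,
        ∃ w ∈ koszulSupported R M (A₀ ∪ B) (i + 1), koszulDifferential x M i w = t • z) →
        t ∈ q.asIdeal := by
    intro B
    induction B using Finset.induction_on with
    | empty => simpa using hbase
    | insert a B _ ih =>
      intro t ht
      rw [Finset.union_insert] at ht
      exact mem_of_smul_cycles_le_insert x (hx a) ih ht
  rw [Module.mem_support_iff_of_finite]
  intro t ht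
  obtain ⟨π, -, hπ⟩ := exists_cycles_to_koszulHomology x M i
  refine hstep Finset.univ t fun z hz => ?_
  obtain ⟨w, hw⟩ := (hπ (t • ⟨z, hz.2⟩)).1 (by
    rw [map_smul]; exact Module.mem_annihilator.1 ht _)
  exact ⟨w, fun S hS => absurd (fun y _ => Finset.mem_union_right _ (Finset.mem_univ y)) hS, hw⟩

end Rigidity

/-! ### The boundaries of the Koszul complex and the delta invariant -/

section AnnihilatorQuotient

variable {R : Type u} [CommRing R]

/-- If `R` and the Koszul homology modules in degrees `≤ k` have depth at least `d`, then so have the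
cycles and the boundaries in degree `k`: the sequences `0 → B_i → Z_i → H_i → 0` and
`0 → Z_{i+1} → K_{i+1} → B_i → 0` present all of these as kernels. -/
theorem depthGE_koszulCycles_and_boundaries [IsLocalRing R] {n : ℕ} (x : Fin n → R) {d : ℕ}
    (hR : DepthGE R d R) {k : ℕ} (hH : ∀ i ≤ k, DepthGE R d (koszulHomology x R i)) :
    DepthGE R d (koszulCycles x R k) ∧
      DepthGE R d (LinearMap.range (koszulDifferential x R k)) := by
  have boundaries (i : ℕ) (hZ : DepthGE R d (koszulCycles x R i))
      (hHi : DepthGE R d (koszulHomology x R i)) :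
      DepthGE R d (LinearMap.range (koszulDifferential x R i)) := by
    obtain ⟨π, hsurj, hπ⟩ := exists_cycles_to_koszulHomology x R i
    refine (DepthGE.ker hsurj hZ hHi).of_linearEquiv ?_
    refine (LinearEquiv.ofEq _ _ ?_).trans
      (Submodule.submoduleOfEquivOfLe (range_koszulDifferential_le x R i))
    ext z
    exact hπ z
  have chains (i : ℕ) : DepthGE R d (KoszulChain n R i) := hR.pi _
  induction k with
  | zero =>
    have hZ : DepthGE R d (koszulCycles x R 0) :=
      (chains 0).of_linearEquiv Submodule.topEquiv.symm
    exact ⟨hZ, boundaries 0 hZ (hH 0 le_rfl)⟩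
  | succ k ih =>
    have hB := (ih fun i hi => hH i (hi.trans k.le_succ)).2
    have hZ : DepthGE R d (koszulCycles x R (k + 1)) := by
      have := DepthGE.ker (LinearMap.surjective_rangeRestrict (koszulDifferential x R k))
        (chains (k + 1)) hB
      rwa [LinearMap.ker_rangeRestrict] at this
    exact ⟨hZ, boundaries _ hZ (hH _ le_rfl)⟩

/-- The top Koszul differential `R → R^{n+1}` has the entries `± x_j`, so its kernel is the
annihilator of `(x_0, …, x_n)` and its range is `R / Ann(x_0, …, x_n)`. -/
noncomputable def quotientAnnihilatorEquivRange {n : ℕ} (x : Fin (n + 1) → R) :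
    (R ⧸ (Ideal.span (Set.range x)).annihilator) ≃ₗ[R]
      LinearMap.range (koszulDifferential x R n) := by
  let f : R →ₗ[R] KoszulChain (n + 1) R (n + 1) := LinearMap.pi fun _ => LinearMap.id
  have hf : Function.Surjective f := fun w => by
    refine ⟨w ⟨Finset.univ, by simp⟩, funext fun S => ?_⟩
    have : S = ⟨Finset.univ, by simp⟩ :=
      Subtype.ext ((Finset.card_eq_iff_eq_univ _).1 (by simp [S.2]))
    rw [this]
    rfl
  have hker : (Ideal.span (Set.range x)).annihilator =
      LinearMap.ker (koszulDifferential x R n ∘ₗ f) := by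
    ext r
    rw [Submodule.mem_annihilator_span, LinearMap.mem_ker]
    constructor
    · intro h
      funext T
      rw [LinearMap.comp_apply, koszulDifferential_apply]
      refine Finset.sum_eq_zero fun j _ => ?_
      split_ifs
      · rfl
      · have := h ⟨x j, j, rfl⟩
        rw [smul_eq_mul, mul_comm] at this
        change _ • (x j * r) = 0
        rw [this, smul_zero]
    · rintro h ⟨_, j, rfl⟩
      have h' := congrFun h ⟨Finset.univ.erase j, by simp [Finset.card_erase_of_mem]⟩
      rw [LinearMap.comp_apply, koszulDifferential_apply,
        Finset.sum_eq_single j (fun k _ hk => dif_pos (by simp [hk])) (by simp),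
        dif_neg (by simp)] at h'
      have h₁ : koszulSign (Finset.univ.erase j) j • (x j * r) = 0 := h'
      have h₂ := congrArg (koszulSign (Finset.univ.erase j) j • ·) h₁
      rw [smul_eq_mul]
      simpa only [← mul_smul, koszulSign_mul_self, one_smul, smul_zero, mul_comm (x j)] using h₂
  exact (Submodule.quotEquivOfEq _ _ hker).trans ((LinearMap.quotKerEquivRange _).trans
    (LinearEquiv.ofEq _ _ (LinearMap.range_comp_of_range_eq_top _ (LinearMap.range_eq_top.2 hf))))

/-- A nonzero free module is faithful, whereas `J` annihilates `R / J`. -/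
theorem hasNoFreeSummand_quotient {J : Ideal R} (hJ : J ≠ ⊥) : HasNoFreeSummand R (R ⧸ J) := by
  intro F N _ hF
  obtain ⟨s, hs, hs0⟩ := Submodule.exists_mem_ne_zero_of_ne_bot hJ
  by_contra hne
  have : Nontrivial F := (Submodule.nontrivial_iff_ne_bot).2 hne
  refine hs0 (FaithfulSMul.eq_of_smul_eq_smul (M := R) (α := F) fun y => ?_)
  rw [zero_smul]
  refine Subtype.ext ?_
  obtain ⟨r, hr⟩ := Ideal.Quotient.mk_surjective (y : R ⧸ J)
  change s • (y : R ⧸ J) = 0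
  rw [← hr, Algebra.smul_def, Ideal.Quotient.algebraMap_eq, ← map_mul,
    Ideal.Quotient.eq_zero_iff_mem]
  exact J.mul_mem_right r hs

variable [IsLocalRing R]

theorem deltaInvariant_eq_zero {L : Type u} [AddCommGroup L] [Module R L]
    (hL : IsMaximalCohenMacaulay R L) (hF : HasNoFreeSummand R L) : deltaInvariant R L = 0 := by
  have htop : cmPart R L = ⊤ :=
    top_le_iff.1 (le_sSup ⟨ModuleCat.of R L, LinearMap.id, hL, hF, LinearMap.range_id.symm⟩)
  have : Subsingleton (L ⧸ cmPart R L) := Submodule.Quotient.subsingleton_iff.2 htop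
  rw [deltaInvariant, Subsingleton.elim (⊤ : Submodule R (L ⧸ cmPart R L)) ⊥,
    Submodule.spanFinrank_bot]

theorem isMaximalCohenMacaulay_of_depthGE [IsNoetherianRing R] {M : Type u} [AddCommGroup M]
    [Module R M] [Module.Finite R M] [Nontrivial M] {d : ℕ} (hd : ringKrullDim R = d)
    (h : DepthGE R d M) : IsMaximalCohenMacaulay R M := by
  refine ⟨inferInstance, inferInstance, ?_⟩
  have hge := h.le_moduleDepth
  have hle : moduleDepth R M ≤ d := by
    by_contra! hlt
    obtain ⟨p, hp⟩ := associatedPrimes.nonempty R M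
    have h1 : ((d + 1 : ℕ) : ℕ∞) ≤ moduleDepth R M := by
      push_cast
      exact Order.add_one_le_of_lt hlt
    have h2 := le_supportDim_of_isAssociatedPrime (p := ⟨p, hp.isPrime⟩) h1 hp (N := R)
      (Module.mem_support_iff_of_finite.2 fun r hr => by
        have hr1 := Module.mem_annihilator.1 hr 1
        rw [smul_eq_mul, mul_one] at hr1
        rw [hr1]
        exact p.zero_mem)
    rw [Module.supportDim_self_eq_ringKrullDim, hd] at h2
    have : d + 1 ≤ d := by exact_mod_cast h2
    omega
  rw [le_antisymm hle hge, hd]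
  rfl

/-- If `Ann I ≠ 0`, then `R / Ann I`, as the module of boundaries next to the top degree of the
Koszul complex, is maximal Cohen–Macaulay. -/
theorem isMaximalCohenMacaulay_quotient_annihilator (hR : IsCohenMacaulayLocalRing R)
    {I : Ideal R} (hI : I ≠ ⊥) (hSCM : IsStronglyCohenMacaulay I) (hAnn : I.annihilator ≠ ⊥) :
    IsMaximalCohenMacaulay R (R ⧸ I.annihilator) := by
  obtain ⟨hnoeth, -, hcm⟩ := hR
  have hdepth : ((moduleDepth R R : ℕ∞) : WithBot ℕ∞) = ringKrullDim R := by
    rw [← Module.supportDim_self_eq_ringKrullDim]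
    exact hcm.resolve_left (not_subsingleton R)
  obtain ⟨d, hd⟩ : ∃ d : ℕ, ringKrullDim R = d := by
    have := ringKrullDim_lt_top (R := R)
    rw [← hdepth] at this ⊢
    obtain ⟨d, hd⟩ := ENat.ne_top_iff_exists.1 (WithBot.coe_lt_coe.1 this).ne
    exact ⟨d, by rw [← hd]; rfl⟩
  have hd' : (d : ℕ∞) ≤ moduleDepth R R := by
    rw [hd] at hdepth
    exact (WithBot.coe_injective hdepth).ge
  obtain ⟨n, x, rfl, hH⟩ := hSCM
  have : Nontrivial (Ideal.span (Set.range x)).annihilator :=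
    (Submodule.nontrivial_iff_ne_bot).2 hAnn
  obtain ⟨p, hp⟩ := associatedPrimes.nonempty R (Ideal.span (Set.range x)).annihilator
  obtain ⟨hprime, s, hs⟩ := isAssociatedPrime_iff.1 hp
  have hpR : IsAssociatedPrime p R :=
    hp.map_of_injective (Submodule.subtype _) (Submodule.injective_subtype _)
  have hsx (j : Fin n) : x j • (s : R) = 0 := by
    have := (Submodule.mem_annihilator.1 s.2) (x j) (Ideal.subset_span ⟨j, rfl⟩)
    rwa [smul_eq_mul, mul_comm] at this
  have hmem (t : R) : t • (s : R) = 0 ↔ t ∈ p := by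
    rw [hs, Submodule.mem_colon_singleton, Submodule.mem_bot]
    exact ⟨fun h => Subtype.ext h, fun h => congrArg Subtype.val h⟩
  -- `p` is an associated prime of `R` in the support of `H_i`, so the Cohen–Macaulay module `H_i`
  -- has dimension, hence depth, at least `d`.
  have hHdepth (i : ℕ) (hi : i ≤ n) : DepthGE R d (koszulHomology x R i) := by
    have := (hH i).1
    have hsupp : (⟨p, hprime⟩ : PrimeSpectrum R) ∈ Module.support R (koszulHomology x R i) :=
      mem_support_koszulHomology x (fun j => (hmem _).1 (hsx j)) hsx (fun t => (hmem t).1) hi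
    have hnt : Nontrivial (koszulHomology x R i) :=
      Module.nonempty_support_iff.1 ⟨_, hsupp⟩
    refine DepthGE.of_le_moduleDepth ?_
    have h1 := le_supportDim_of_isAssociatedPrime hd' (p := ⟨p, hprime⟩) hpR hsupp
    rw [← (hH i).2.resolve_left (not_subsingleton _)] at h1
    exact WithBot.coe_le_coe.1 h1
  -- An empty generating sequence would give `I = 0`.
  obtain _ | n := n
  · exact absurd (by simp [Set.range_eq_empty]) hI
  have hnt : Nontrivial (R ⧸ (Ideal.span (Set.range x)).annihilator) :=
    Ideal.Quotient.nontrivial_iff.2 fun h => hI ((Submodule.annihilator_eq_top_iff).1 h)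
  refine isMaximalCohenMacaulay_of_depthGE hd ?_
  exact (depthGE_koszulCycles_and_boundaries x (DepthGE.of_le_moduleDepth hd')
    fun i hi => hHdepth i (hi.trans n.le_succ)).2.of_linearEquiv
      (quotientAnnihilatorEquivRange x).symm

end AnnihilatorQuotient

theorem theorem2p3 (R : Type u) [CommRing R] [IsLocalRing R]
    (hR : IsCohenMacaulayLocalRing R)
    (hω : ∃ ω : ModuleCat.{u} R, IsCanonicalModule R ω)
    (I : Ideal R) (hI : I ≠ ⊥) (hSCM : IsStronglyCohenMacaulay I)
    (hAnn : I.annihilator ≠ ⊥) :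
    deltaInvariant R (R ⧸ I.annihilator) = 0 :=
  deltaInvariant_eq_zero (isMaximalCohenMacaulay_quotient_annihilator hR hI hSCM hAnn)
    (hasNoFreeSummand_quotient hAnn)
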